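/- Let $1\le k\le m_1$ and $1\le q\le m_2$ be integers, and equip $\mathbb{R}^{m_1\times m_2}$ with the Frobenius inner product and norm $\|\cdot\|_F$. For $1\le j\le m$ let $\widetilde{\mathcal A}^m_j$ be the set of vectors $a\in\mathbb{R}^m$ with exactly $j$ non-zero entries, all of absolute value $1/\sqrt j$, and let $$\widetilde{\mathcal A}_{k,q}=\{ab^{\top} : a\in\widetilde{\mathcal A}^{m_1}_k,\ b\in\widetilde{\mathcal A}^{m_2}_q\}.$$ The $(k,q)$-CUT norm is the gauge $\widetilde\Omega_{k,q}(Z)=\inf\{t>0 : Z\in t\,\mathrm{conv}(\widetilde{\mathcal A}_{k,q})\}$. For a convex function $\Omega$ on $\mathbb{R}^{m_1\times m_2}$ and a matrix $Z$, let $$T_\Omega(Z)=\overline{\bigcup_{\tau>0}\{H : \Omega(Z+\tau H)\le\Omega(Z)\}},\qquad \mathfrak S(Z,\Omega)=\mathbb{E}\big[\|\Pi_{T_\Omega(Z)}(G)\|_F^2\big],$$ where $G$ is a random matrix with i.i.d. standard normal entries and $\Pi_T$ is the orthogonal projection onto the closed convex cone $T$ ($\mathfrak S(Z,\Omega)$ is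 the statistical dimension of $\Omega$ at $Z$). Then for every $A\in\widetilde{\mathcal A}_{k,q}$ the expectation defining $\mathfrak S(A,\widetilde\Omega_{k,q})$ is finite, and $$\mathfrak S(A,\widetilde\Omega_{k,q})\ \le\ 16(k+q)+9\Big(k\log\frac{m_1}{k}+q\log\frac{m_2}{q}\Big).$$ Moreover, the unit ball $\{Z : \widetilde\Omega_{k,q}(Z)\le 1\}$ is a vertex-transitive polytope (its isometric symmetries act transitively on its vertices), its vertices are exactly the elements of $\widetilde{\mathcal A}_{k,q}$, and there are $2^{k+q-1}\binom{m_1}{k}\binom{m_2}{q}$ of them. -/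

import Mathlib

namespace SparseCut

open Set MeasureTheory ProbabilityTheory

/-- The space `ℝ^{m₁ × m₂}` of real matrices, with the Frobenius inner product and norm. -/
abbrev RMat (m₁ m₂ : ℕ) : Type := EuclideanSpace ℝ (Fin m₁ × Fin m₂)

/-- The outer product `a bᵀ`. -/
def outer {m₁ m₂ : ℕ} (a : Fin m₁ → ℝ) (b : Fin m₂ → ℝ) : RMat m₁ m₂ :=
  WithLp.toLp 2 fun p => a p.1 * b p.2

/-- The vectors of `ℝ^m` with exactly `k` non-zero entries, all of absolute value `1 / √k`. -/
def flatVec (m k : ℕ) : Set (Fin m → ℝ) :=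
  {a | hammingNorm a = k ∧ ∀ i, a i ≠ 0 → |a i| = 1 / Real.sqrt k}

/-- The atoms `a bᵀ` of the `(k,q)`-CUT norm. -/
def cutAtoms (m₁ m₂ k q : ℕ) : Set (RMat m₁ m₂) :=
  {A | ∃ a ∈ flatVec m₁ k, ∃ b ∈ flatVec m₂ q, A = outer a b}

/-- The gauge function `x ↦ inf {t > 0 : x ∈ t conv(𝒜)}` of a set of atoms. -/
noncomputable def atomicNorm {E : Type*} [AddCommGroup E] [Module ℝ E] (𝒜 : Set E) : E → ℝ :=
  gauge (convexHull ℝ 𝒜)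

/-- The `(k,q)`-CUT norm. -/
noncomputable def cutNorm (m₁ m₂ k q : ℕ) : RMat m₁ m₂ → ℝ :=
  atomicNorm (cutAtoms m₁ m₂ k q)

section StatisticalDimension

variable {E : Type*} [NormedAddCommGroup E] [InnerProductSpace ℝ E]

/-- The tangent cone of `f` at `z`: the closure of the set of descent directions. -/
def descentCone (f : E → ℝ) (z : E) : Set E :=
  closure (⋃ τ : {τ : ℝ // 0 < τ}, {h : E | f (z + τ.1 • h) ≤ f z})

/-- `p` is a point of `K` nearest to `x`. -/
def IsNearest (K : Set E) (x p : E) : Prop :=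
  p ∈ K ∧ ∀ y ∈ K, ‖x - p‖ ≤ ‖x - y‖

/-- The orthogonal (metric) projection onto a non-empty closed convex set. -/
noncomputable def metricProj (K : Set E) (x : E) : E :=
  Classical.epsilon (IsNearest K x)

theorem isNearest_metricProj [FiniteDimensional ℝ E] {K : Set E} (hK : IsClosed K)
    (hne : K.Nonempty) (x : E) : IsNearest K x (metricProj K x) := by
  apply Classical.epsilon_spec (p := IsNearest K x)
  have : ProperSpace E := FiniteDimensional.proper ℝ E
  obtain ⟨p, hp, h⟩ := hK.exists_infDist_eq_dist hne x
  refine ⟨p, hp, fun y hy => ?_⟩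
  rw [← dist_eq_norm, ← dist_eq_norm, ← h]
  exact Metric.infDist_le_dist_of_mem hy

theorem IsNearest.unique {K : Set E} (hK : Convex ℝ K) {x p p' : E}
    (h : IsNearest K x p) (h' : IsNearest K x p') : p = p' := by
  have hm := h.2 _ (hK h.1 h'.1 (by norm_num : (0 : ℝ) ≤ 1 / 2)
    (by norm_num : (0 : ℝ) ≤ 1 / 2) (by norm_num))
  have he : ‖x - p‖ = ‖x - p'‖ := le_antisymm (h.2 _ h'.1) (h'.2 _ h.1)
  have hpar := parallelogram_law_with_norm ℝ (x - p) (x - p')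
  have h1 : x - p + (x - p') = (2 : ℝ) • (x - ((1 / 2 : ℝ) • p + (1 / 2 : ℝ) • p')) := by
    module
  rw [h1, norm_smul] at hpar
  have h2 : ‖x - p - (x - p')‖ = 0 := by
    have : ‖(2 : ℝ)‖ = 2 := by norm_num
    rw [this] at hpar
    nlinarith [norm_nonneg (x - p), norm_nonneg (x - p - (x - p'))]
  have h3 := norm_eq_zero.mp h2
  have h4 : p' - p = 0 := by rw [← h3]; abel
  exact (sub_eq_zero.mp h4).symm

variable [FiniteDimensional ℝ E] [MeasurableSpace E] [BorelSpace E]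

/-- `G ↦ ‖Π_T(G)‖²`, with `T` the tangent cone of `f` at `z`. -/
noncomputable def sqNormProj (f : E → ℝ) (z : E) (g : E) : ℝ :=
  ‖metricProj (descentCone f z) g‖ ^ 2

/-- The statistical dimension `𝔼 ‖Π_T(G)‖²` of `f` at `z`, where `G` is a standard Gaussian
vector of `E` (on `RMat m₁ m₂`: a matrix with i.i.d. standard normal entries, see
`ProbabilityTheory.map_pi_eq_stdGaussian`). -/
noncomputable def statDim (f : E → ℝ) (z : E) : ℝ :=
  ∫ g, sqNormProj f z g ∂(stdGaussian E)

end StatisticalDimension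

/-- A polytope whose group of isometric symmetries acts transitively on its vertices. -/
def IsVertexTransitivePolytope {E : Type*} [NormedAddCommGroup E] [InnerProductSpace ℝ E]
    (P : Set E) : Prop :=
  (∃ S : Set E, S.Finite ∧ P = convexHull ℝ S) ∧
    ∀ v ∈ extremePoints ℝ P, ∀ w ∈ extremePoints ℝ P,
      ∃ φ : E ≃ᵃⁱ[ℝ] E, φ '' P = P ∧ φ v = w

end SparseCut

namespace SparseCut

open Set MeasureTheory ProbabilityTheory
open scoped ENNReal

/-! ### Maurey's property (τ) for Gaussian measures, via Prékopa–Leindler -/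

section PropertyTau

/-! The unit ball is the convex hull of `N` atoms on the unit sphere, and signed permutations of
rows and columns act transitively on the atoms. This gives the vertices and the symmetry; the count
follows since `(a, b) ↦ a bᵀ` is exactly two-to-one on pairs of flat vectors.

For the statistical dimension, the normal cones at the `N` atoms cover the space and have equal
Gaussian measure, so the cone `K` at `A` has measure at least `1 / N`. If `y ∈ K`, polarity gives
`‖Π_T g‖ ≤ ‖g - y‖`, hence `exp (‖Π_T g‖² / 4) · 1_K(y) ≤ exp (‖g - y‖² / 4)`. Property (τ) turns
this pointwise bound into `𝔼 exp (‖Π_T G‖² / 4) ≤ 1 / γ(K) ≤ N`, and Jensen gives `𝔼 ‖Π_T G‖² ≤ 4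
log N`. It remains to bound `log N` using `C(m, k) ≤ (e m / k)^k`.

Property (τ) is proved on the line by comparing level sets, then tensorized. The carrying lemmas are
`stdGaussian_lintegral_mul_le_one`, `norm_metricProj_descentCone_le` and
`one_le_card_mul_stdGaussian_normalCone`. -/

theorem volume_add_volume_le_of_midpoint_mem {A B C : Set ℝ} (hA : A.Nonempty) (hB : B.Nonempty)
    (hC : C.OrdConnected) (h : ∀ a ∈ A, ∀ b ∈ B, (a + b) / 2 ∈ C) :
    volume A + volume B ≤ 2 * volume C := by
  have key : ∀ a₁ ∈ A, ∀ a₂ ∈ A, a₁ ≤ a₂ → ∀ b₁ ∈ B, ∀ b₂ ∈ B, b₁ ≤ b₂ →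
      edist a₁ a₂ + edist b₁ b₂ ≤ 2 * volume C := by
    intro a₁ ha₁ a₂ ha₂ ha b₁ hb₁ b₂ hb₂ hb
    have hsub : Icc ((a₁ + b₁) / 2) ((a₂ + b₂) / 2) ⊆ C := hC.out (h _ ha₁ _ hb₁) (h _ ha₂ _ hb₂)
    have hv := measure_mono (μ := volume) hsub
    rw [Real.volume_Icc] at hv
    rw [edist_comm a₁, edist_comm b₁, edist_dist, edist_dist, Real.dist_eq, Real.dist_eq,
      abs_of_nonneg (sub_nonneg.2 ha), abs_of_nonneg (sub_nonneg.2 hb),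
      ← ENNReal.ofReal_add (sub_nonneg.2 ha) (sub_nonneg.2 hb)]
    calc ENNReal.ofReal (a₂ - a₁ + (b₂ - b₁))
        = 2 * ENNReal.ofReal ((a₂ + b₂) / 2 - (a₁ + b₁) / 2) := by
          rw [show (2 : ℝ≥0∞) = ENNReal.ofReal 2 by simp, ← ENNReal.ofReal_mul (by norm_num)]
          congr 1; ring
      _ ≤ _ := by gcongr
  have key' : ∀ a₁ ∈ A, ∀ a₂ ∈ A, ∀ b₁ ∈ B, ∀ b₂ ∈ B,
      edist a₁ a₂ + edist b₁ b₂ ≤ 2 * volume C := by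
    intro a₁ ha₁ a₂ ha₂ b₁ hb₁ b₂ hb₂
    rcases le_total a₁ a₂ with ha | ha <;> rcases le_total b₁ b₂ with hb | hb
    · exact key _ ha₁ _ ha₂ ha _ hb₁ _ hb₂ hb
    · rw [edist_comm b₁]; exact key _ ha₁ _ ha₂ ha _ hb₂ _ hb₁ hb
    · rw [edist_comm a₁]; exact key _ ha₂ _ ha₁ ha _ hb₁ _ hb₂ hb
    · rw [edist_comm a₁, edist_comm b₁]; exact key _ ha₂ _ ha₁ ha _ hb₂ _ hb₁ hb
  rcases eq_or_ne (2 * volume C) ∞ with hX | hX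
  · rw [hX]; exact le_top
  -- Since `C` is an interval, bounding diameters suffices: `volume A ≤ diam A`, so `A` and `B` need
  -- not be measurable. The supremum is taken over pairs in `A` with a pair in `B` fixed, then over
  -- `B`.
  set X := 2 * volume C
  obtain ⟨b₀, hb₀⟩ := hB
  have hdA : Metric.ediam A ≤ X := Metric.ediam_le fun x hx y hy => by
    simpa using key' x hx y hy b₀ hb₀ b₀ hb₀
  have hdB : Metric.ediam B ≤ X - Metric.ediam A := Metric.ediam_le fun x hx y hy => by
    apply ENNReal.le_sub_of_add_le_left (ne_top_of_le_ne_top hX hdA)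
    rw [add_comm]
    have : Metric.ediam A ≤ X - edist x y := Metric.ediam_le fun a ha a' ha' =>
      ENNReal.le_sub_of_add_le_right (edist_ne_top _ _) (key' a ha a' ha' x hx y hy)
    have h2 : edist x y ≤ X := by
      obtain ⟨a, ha⟩ := hA
      simpa using key' a ha a ha x hx y hy
    calc edist x y + Metric.ediam A ≤ edist x y + (X - edist x y) := by gcongr
      _ = X := add_tsub_cancel_of_le h2
  calc volume A + volume B ≤ Metric.ediam A + Metric.ediam B :=
        add_le_add (Real.volume_le_diam A) (Real.volume_le_diam B)
    _ ≤ Metric.ediam A + (X - Metric.ediam A) := by gcongr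
    _ = X := add_tsub_cancel_of_le hdA

theorem ennreal_mul_le_one_of_add_le_two {a b : ℝ≥0∞} (h : a + b ≤ 2) : a * b ≤ 1 := by
  have ha : a ≠ ∞ := ne_top_of_le_ne_top (by simp) (le_self_add.trans h)
  have hb : b ≠ ∞ := ne_top_of_le_ne_top (by simp) (le_add_self.trans h)
  lift a to NNReal using ha
  lift b to NNReal using hb
  norm_cast at h ⊢
  have h' : (a : ℝ) + b ≤ 2 := by exact_mod_cast h
  have : (a : ℝ) * b ≤ 1 := by nlinarith [sq_nonneg ((a : ℝ) - b), a.2, b.2]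
  exact_mod_cast this

/-- A one-dimensional Prékopa–Leindler inequality against a quasi-concave function. -/
theorem lintegral_mul_lintegral_le_one {u v : ℝ → ℝ≥0∞} {φ : ℝ → ℝ}
    (hu : Measurable u) (hv : Measurable v) (hφ : Measurable φ) (hφ0 : ∀ x, 0 ≤ φ x)
    (hφC : ∀ t, {x | t < φ x}.OrdConnected) {B : ℝ} (hφB : ∀ x, φ x ≤ B)
    (hφ1 : ∫⁻ x, ENNReal.ofReal (φ x) = 1)
    (h : ∀ x y, u x * v y ≤ ENNReal.ofReal (φ ((x + y) / 2)) ^ 2) :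
    (∫⁻ x, u x) * ∫⁻ x, v x ≤ 1 := by
  set a := ⨆ x, u x with ha
  set b := ⨆ x, v x with hb
  have hab : a * b ≤ ENNReal.ofReal B ^ 2 := by
    rw [ha, ENNReal.iSup_mul]
    refine iSup_le fun x => ?_
    rw [hb, ENNReal.mul_iSup]
    refine iSup_le fun y => (h x y).trans ?_
    gcongr
    exact hφB _
  have zero_of : ∀ w : ℝ → ℝ≥0∞, (⨆ x, w x) = 0 → ∫⁻ x, w x = 0 := by
    intro w hw
    rw [ENNReal.iSup_eq_zero] at hw
    simp [hw]
  rcases eq_or_ne a 0 with ha0 | ha0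
  · rw [zero_of u ha0]; simp
  rcases eq_or_ne b 0 with hb0 | hb0
  · rw [zero_of v hb0]; simp
  -- Boundedness of `φ` is what makes both suprema finite once neither vanishes.
  have hfin : ENNReal.ofReal B ^ 2 < ∞ := by finiteness
  have hat : a ≠ ∞ := fun hat => by
    rw [hat, ENNReal.top_mul hb0] at hab
    exact (hab.trans_lt hfin).ne rfl
  have hbt : b ≠ ∞ := fun hbt => by
    rw [hbt, ENNReal.mul_top ha0] at hab
    exact (hab.trans_lt hfin).ne rfl
  have hua : ∀ x, u x ≤ a := fun x => le_iSup u x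
  have hvb : ∀ x, v x ≤ b := fun x => le_iSup v x
  -- rescale so that both functions have the same supremum
  set α := a.toReal with hα
  set β := b.toReal with hβ
  have hαp : 0 < α := ENNReal.toReal_pos ha0 hat
  have hβp : 0 < β := ENNReal.toReal_pos hb0 hbt
  set c := Real.sqrt (β / α) with hc
  have hcp : 0 < c := Real.sqrt_pos.2 (div_pos hβp hαp)
  have hc2 : c ^ 2 = β / α := Real.sq_sqrt (div_pos hβp hαp).le
  set U : ℝ → ℝ := fun x => c * (u x).toReal with hU
  set V : ℝ → ℝ := fun x => c⁻¹ * (v x).toReal with hV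
  have hut : ∀ x, u x ≠ ∞ := fun x => ne_top_of_le_ne_top hat (hua x)
  have hvt : ∀ x, v x ≠ ∞ := fun x => ne_top_of_le_ne_top hbt (hvb x)
  have hU0 : ∀ x, 0 ≤ U x := fun x => by positivity
  have hV0 : ∀ x, 0 ≤ V x := fun x => by positivity
  have hUV : ∀ x y, U x * V y ≤ φ ((x + y) / 2) ^ 2 := by
    intro x y
    have := ENNReal.toReal_mono (by finiteness) (h x y)
    rw [ENNReal.toReal_mul, ENNReal.toReal_pow, ENNReal.toReal_ofReal (hφ0 _)] at this
    calc U x * V y = (u x).toReal * (v y).toReal := by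
          simp only [hU, hV]; field_simp
      _ ≤ _ := this
  have hmax : c * α = c⁻¹ * β := by
    rw [← div_eq_inv_mul, eq_div_iff hcp.ne']
    rw [eq_div_iff hαp.ne'] at hc2
    linarith
  have hUne : ∀ t, t < c * α → {x | t < U x}.Nonempty := by
    intro t ht
    by_contra hne
    have hne : ∀ x, U x ≤ t := fun x => not_lt.1 fun hx => hne ⟨x, hx⟩
    have : a ≤ ENNReal.ofReal (t / c) := iSup_le fun x => by
      have := hne x
      rw [← ENNReal.ofReal_toReal (hut x)]
      exact ENNReal.ofReal_le_ofReal ((le_div_iff₀' hcp).2 this)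
    have h2 : 0 ≤ t := le_trans (hU0 0) (hne 0)
    have := ENNReal.toReal_mono (by finiteness) this
    rw [ENNReal.toReal_ofReal (by positivity), le_div_iff₀' hcp] at this
    exact absurd ht (not_lt.2 this)
  have hVne : ∀ t, t < c⁻¹ * β → {x | t < V x}.Nonempty := by
    intro t ht
    by_contra hne
    have hne : ∀ x, V x ≤ t := fun x => not_lt.1 fun hx => hne ⟨x, hx⟩
    have : b ≤ ENNReal.ofReal (t * c) := iSup_le fun x => by
      have := hne x
      rw [← ENNReal.ofReal_toReal (hvt x)]
      exact ENNReal.ofReal_le_ofReal ((inv_mul_le_iff₀' hcp).1 this)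
    have h2 : 0 ≤ t := le_trans (hV0 0) (hne 0)
    have := ENNReal.toReal_mono (by finiteness) this
    rw [ENNReal.toReal_ofReal (by positivity), ← inv_mul_le_iff₀' hcp] at this
    exact absurd ht (not_lt.2 this)
  have hUm : Measurable U := hu.ennreal_toReal.const_mul c
  have hVm : Measurable V := hv.ennreal_toReal.const_mul c⁻¹
  have hsum : (∫⁻ x, ENNReal.ofReal (U x)) + (∫⁻ x, ENNReal.ofReal (V x)) ≤ 2 := by
    rw [lintegral_eq_lintegral_meas_lt volume (.of_forall hU0) hUm.aemeasurable,
      lintegral_eq_lintegral_meas_lt volume (.of_forall hV0) hVm.aemeasurable,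
      ← lintegral_add_left]
    · calc _ ≤ ∫⁻ t in Ioi (0 : ℝ), 2 * volume {x | t < φ x} := by
            refine setLIntegral_mono' measurableSet_Ioi fun t ht => ?_
            -- Below the common supremum both level sets are non-empty, as the midpoint inequality
            -- requires; from it on both are empty. Without the rescaling just one of them could be
            -- empty.
            rcases lt_or_ge t (c * α) with htc | htc
            · refine volume_add_volume_le_of_midpoint_mem (hUne t htc) (hVne t (hmax ▸ htc))
                (hφC t) fun x hx y hy => ?_
              have h1 : t < U x := hx
              have h2 : t < V y := hy
              have h0 : (0 : ℝ) < t := ht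
              have : t ^ 2 < φ ((x + y) / 2) ^ 2 := by
                refine lt_of_lt_of_le ?_ (hUV x y)
                nlinarith
              exact lt_of_pow_lt_pow_left₀ 2 (hφ0 _) this
            · have e1 : {x | t < U x} = ∅ := by
                refine eq_empty_of_forall_notMem fun x hx => ?_
                have h1 : t < U x := hx
                have : U x ≤ c * α := by
                  simp only [hU]; gcongr; exact ENNReal.toReal_mono hat (hua x)
                linarith
              have e2 : {x | t < V x} = ∅ := by
                refine eq_empty_of_forall_notMem fun x hx => ?_
                have h1 : t < V x := hx
                have : V x ≤ c⁻¹ * β := by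
                  simp only [hV]; gcongr; exact ENNReal.toReal_mono hbt (hvb x)
                linarith
              rw [e1, e2]; simp
        _ = 2 * ∫⁻ x, ENNReal.ofReal (φ x) := by
            rw [lintegral_eq_lintegral_meas_lt volume (.of_forall hφ0) hφ.aemeasurable,
              lintegral_const_mul' _ _ (by simp)]
        _ = 2 := by rw [hφ1, mul_one]
    · exact Antitone.measurable fun s t hst => measure_mono fun x hx => lt_of_le_of_lt hst hx
  have hprod := ennreal_mul_le_one_of_add_le_two hsum
  have e1 : ∫⁻ x, ENNReal.ofReal (U x) = ENNReal.ofReal c * ∫⁻ x, u x := by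
    rw [← lintegral_const_mul _ hu]
    congr 1; ext x
    rw [ENNReal.ofReal_mul hcp.le, ENNReal.ofReal_toReal (hut x)]
  have e2 : ∫⁻ x, ENNReal.ofReal (V x) = ENNReal.ofReal c⁻¹ * ∫⁻ x, v x := by
    rw [← lintegral_const_mul _ hv]
    congr 1; ext x
    rw [ENNReal.ofReal_mul (inv_pos.2 hcp).le, ENNReal.ofReal_toReal (hvt x)]
  rw [e1, e2, mul_mul_mul_comm, ← ENNReal.ofReal_mul hcp.le, mul_inv_cancel₀ hcp.ne'] at hprod
  simpa using hprod

/-- Maurey's property (τ) of the one-dimensional Gaussian measure. -/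
theorem gaussianReal_lintegral_mul_le_one {f g : ℝ → ℝ≥0∞} (hf : Measurable f) (hg : Measurable g)
    (h : ∀ x y, f x * g y ≤ ENNReal.ofReal (Real.exp ((x - y) ^ 2 / 4))) :
    (∫⁻ x, f x ∂gaussianReal 0 1) * ∫⁻ x, g x ∂gaussianReal 0 1 ≤ 1 := by
  have hφm : Measurable (gaussianPDF 0 1) := measurable_gaussianPDF 0 1
  rw [gaussianReal_of_var_ne_zero 0 one_ne_zero, lintegral_withDensity_eq_lintegral_mul _ hφm hf,
    lintegral_withDensity_eq_lintegral_mul _ hφm hg]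
  have hpdf : ∀ x, gaussianPDFReal 0 1 x = (√(2 * Real.pi))⁻¹ * Real.exp (-x ^ 2 / 2) := by
    intro x; simp [gaussianPDFReal]
  have hpos : 0 < (√(2 * Real.pi))⁻¹ := by positivity
  refine lintegral_mul_lintegral_le_one (φ := gaussianPDFReal 0 1) (B := (√(2 * Real.pi))⁻¹)
    (hφm.mul hf) (hφm.mul hg) (measurable_gaussianPDFReal 0 1) (gaussianPDFReal_nonneg 0 1)
    ?_ ?_ (lintegral_gaussianPDFReal_eq_one 0 one_ne_zero) ?_
  · refine fun t => ⟨fun x hx y hy z hz => ?_⟩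
    simp only [mem_ofPred_eq, hpdf] at hx hy ⊢
    rcases le_total 0 z with h0 | h0
    · refine hy.trans_le ?_
      gcongr
      exact hz.2
    · refine hx.trans_le ?_
      gcongr _ * Real.exp ?_
      nlinarith [hz.1]
  · intro x
    rw [hpdf]
    refine mul_le_of_le_one_right hpos.le (Real.exp_le_one_iff.2 ?_)
    nlinarith [sq_nonneg x]
  · intro x y
    calc gaussianPDF 0 1 x * f x * (gaussianPDF 0 1 y * g y)
        = gaussianPDF 0 1 x * gaussianPDF 0 1 y * (f x * g y) := by ring
      _ ≤ gaussianPDF 0 1 x * gaussianPDF 0 1 y *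
          ENNReal.ofReal (Real.exp ((x - y) ^ 2 / 4)) := by gcongr; exact h x y
      _ = _ := by
        rw [gaussianPDF, gaussianPDF, ← ENNReal.ofReal_mul (gaussianPDFReal_nonneg _ _ _),
          ← ENNReal.ofReal_mul (mul_nonneg (gaussianPDFReal_nonneg _ _ _)
            (gaussianPDFReal_nonneg _ _ _)), ← ENNReal.ofReal_pow (gaussianPDFReal_nonneg _ _ _)]
        congr 1
        -- The parallelogram identity `x²/2 + y²/2 = (x+y)²/4 + (x-y)²/4` makes this an equality.
        rw [hpdf, hpdf, hpdf, mul_pow, ← Real.exp_nat_mul]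
        calc _ = ((√(2 * Real.pi))⁻¹) ^ 2 * (Real.exp (-x ^ 2 / 2) * Real.exp (-y ^ 2 / 2) *
              Real.exp ((x - y) ^ 2 / 4)) := by ring
          _ = _ := by
            rw [← Real.exp_add, ← Real.exp_add]
            congr 2
            push_cast; ring

/-- Tensorization of property (τ). -/
theorem pi_gaussianReal_lintegral_mul_le_one {n : ℕ} {f g : (Fin n → ℝ) → ℝ≥0∞}
    (hf : Measurable f) (hg : Measurable g)
    (h : ∀ x y, f x * g y ≤ ENNReal.ofReal (Real.exp ((∑ i, (x i - y i) ^ 2) / 4))) :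
    (∫⁻ x, f x ∂Measure.pi fun _ : Fin n => gaussianReal 0 1) *
      ∫⁻ x, g x ∂Measure.pi (fun _ : Fin n => gaussianReal 0 1) ≤ 1 := by
  induction n with
  | zero =>
    have hc : ∀ w : (Fin 0 → ℝ) → ℝ≥0∞, w = fun _ => w default := fun w =>
      funext fun x => congrArg w (Subsingleton.elim _ _)
    have := h default default
    rw [hc f, hc g, lintegral_const, lintegral_const]
    simpa using this
  | succ n ih =>
    set μ : Measure (Fin n → ℝ) := Measure.pi fun _ => gaussianReal 0 1 with hμ
    have mp := (measurePreserving_piFinSuccAbove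
      (fun _ : Fin (n + 1) => gaussianReal 0 1) 0).symm
    have hsymm : ∀ p : ℝ × (Fin n → ℝ),
        (MeasurableEquiv.piFinSuccAbove (fun _ : Fin (n + 1) => ℝ) 0).symm p =
          Fin.cons p.1 p.2 := fun p => by
      simp [MeasurableEquiv.piFinSuccAbove_symm_apply, Fin.insertNthEquiv]
    have split : ∀ w : (Fin (n + 1) → ℝ) → ℝ≥0∞, Measurable w →
        ∫⁻ x, w x ∂Measure.pi (fun _ : Fin (n + 1) => gaussianReal 0 1) =
          ∫⁻ s, ∫⁻ x, w (Fin.cons s x) ∂μ ∂gaussianReal 0 1 := by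
      intro w hw
      rw [← mp.lintegral_comp hw, lintegral_prod _ (by fun_prop)]
      simp [hμ, hsymm]
    have hcons : Measurable fun p : ℝ × (Fin n → ℝ) => (Fin.cons p.1 p.2 : Fin (n + 1) → ℝ) := by
      simpa only [← hsymm] using
        (MeasurableEquiv.piFinSuccAbove (fun _ : Fin (n + 1) => ℝ) 0).symm.measurable
    rw [split f hf, split g hg]
    refine gaussianReal_lintegral_mul_le_one (hf.comp hcons).lintegral_prod_right'
      (hg.comp hcons).lintegral_prod_right' fun s t => ?_
    set e := Real.exp ((s - t) ^ 2 / 4) with he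
    have hep : 0 < e := Real.exp_pos _
    have hf' : Measurable fun x : Fin n → ℝ => f (Fin.cons s x) :=
      (hf.comp hcons).comp measurable_prodMk_left
    have hg' : Measurable fun x : Fin n → ℝ => g (Fin.cons t x) :=
      (hg.comp hcons).comp measurable_prodMk_left
    -- With the first coordinates `s`, `t` frozen, their share of the cost is a constant and is
    -- absorbed into `g`. The partial integrals then satisfy the one-dimensional hypothesis.
    have := ih (f := fun x => f (Fin.cons s x))
      (g := fun y => ENNReal.ofReal e⁻¹ * g (Fin.cons t y)) hf' (hg'.const_mul _) fun x y => by
        have h1 := h (Fin.cons s x) (Fin.cons t y)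
        simp only [Fin.sum_univ_succ, Fin.cons_zero, Fin.cons_succ] at h1
        rw [add_div, Real.exp_add, ENNReal.ofReal_mul hep.le] at h1
        calc f (Fin.cons s x) * (ENNReal.ofReal e⁻¹ * g (Fin.cons t y))
            = ENNReal.ofReal e⁻¹ * (f (Fin.cons s x) * g (Fin.cons t y)) := by ring
          _ ≤ ENNReal.ofReal e⁻¹ * (ENNReal.ofReal e * _) := by gcongr
          _ = _ := by
            rw [← mul_assoc, ← ENNReal.ofReal_mul (inv_pos.2 hep).le, inv_mul_cancel₀ hep.ne',
              ENNReal.ofReal_one, one_mul]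
    rw [lintegral_const_mul _ hg'] at this
    calc (∫⁻ x, f (Fin.cons s x) ∂μ) * ∫⁻ x, g (Fin.cons t x) ∂μ
        = ENNReal.ofReal e * ((∫⁻ x, f (Fin.cons s x) ∂μ) *
            (ENNReal.ofReal e⁻¹ * ∫⁻ x, g (Fin.cons t x) ∂μ)) := by
          have : ENNReal.ofReal e * ENNReal.ofReal e⁻¹ = 1 := by
            rw [← ENNReal.ofReal_mul hep.le, mul_inv_cancel₀ hep.ne', ENNReal.ofReal_one]
          rw [mul_left_comm, ← mul_assoc (ENNReal.ofReal e), this, one_mul]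
      _ ≤ ENNReal.ofReal e * 1 := by gcongr
      _ = _ := mul_one _

/-- Property (τ) of the standard Gaussian measure of a Euclidean space. -/
theorem stdGaussian_lintegral_mul_le_one {E : Type*} [NormedAddCommGroup E]
    [InnerProductSpace ℝ E] [FiniteDimensional ℝ E] [MeasurableSpace E] [BorelSpace E]
    {f g : E → ℝ≥0∞} (hf : Measurable f) (hg : Measurable g)
    (h : ∀ x y, f x * g y ≤ ENNReal.ofReal (Real.exp (‖x - y‖ ^ 2 / 4))) :
    (∫⁻ x, f x ∂stdGaussian E) * ∫⁻ x, g x ∂stdGaussian E ≤ 1 := by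
  have hm : Measurable fun x : Fin (Module.finrank ℝ E) → ℝ =>
    ∑ i, x i • stdOrthonormalBasis ℝ E i := by fun_prop
  rw [stdGaussian, lintegral_map hf hm, lintegral_map hg hm]
  refine pi_gaussianReal_lintegral_mul_le_one (hf.comp hm) (hg.comp hm) fun x y => ?_
  refine (h _ _).trans_eq ?_
  rw [← Finset.sum_sub_distrib]
  simp_rw [← sub_smul]
  rw [← real_inner_self_eq_norm_sq, (stdOrthonormalBasis ℝ E).orthonormal.inner_sum]
  simp [sq]

end PropertyTau

/-! ### Projection onto the tangent cone and the bound by Gaussian measure of the normal cone -/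

section Cone

variable {E : Type*} [NormedAddCommGroup E] [InnerProductSpace ℝ E]

theorem isClosed_descentCone (f : E → ℝ) (z : E) : IsClosed (descentCone f z) := isClosed_closure

theorem zero_mem_descentCone (f : E → ℝ) (z : E) : (0 : E) ∈ descentCone f z :=
  subset_closure <| mem_iUnion.2 ⟨⟨1, one_pos⟩, by simp⟩

theorem smul_mem_descentCone {f : E → ℝ} {z h : E} (hh : h ∈ descentCone f z) {t : ℝ}
    (ht : 0 ≤ t) : t • h ∈ descentCone f z := by
  rcases ht.eq_or_lt with rfl | ht
  · simpa using zero_mem_descentCone f z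
  · refine map_mem_closure (continuous_const_smul t) hh fun x hx => ?_
    obtain ⟨⟨τ, hτ⟩, hx⟩ := mem_iUnion.1 hx
    refine mem_iUnion.2 ⟨⟨τ / t, div_pos hτ ht⟩, ?_⟩
    simp only [mem_ofPred_eq] at hx ⊢
    rwa [smul_smul, div_mul_cancel₀ _ ht.ne']

theorem inner_nonpos_of_mem_descentCone {f : E → ℝ} {z y : E}
    (hy : ∀ x, f x ≤ f z → inner ℝ x y ≤ inner ℝ z y) {h : E} (hh : h ∈ descentCone f z) :
    inner ℝ h y ≤ 0 := by
  have hcl : IsClosed {h : E | inner ℝ h y ≤ 0} :=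
    isClosed_le (by fun_prop) continuous_const
  refine closure_minimal (fun x hx => ?_) hcl hh
  obtain ⟨⟨τ, hτ⟩, hx⟩ := mem_iUnion.1 hx
  have := hy _ hx
  rw [inner_add_left, real_inner_smul_left] at this
  exact nonpos_of_mul_nonpos_right (by linarith) hτ

/-- Minimality along the ray through `p` is enough, so convexity of the cone plays no role. -/
theorem IsNearest.inner_sub_eq_zero {T : Set E} (hT : ∀ x ∈ T, ∀ t : ℝ, 0 ≤ t → t • x ∈ T)
    {g p : E} (h : IsNearest T g p) : inner ℝ p (g - p) = 0 := by
  have key : ∀ s : ℝ, -1 ≤ s → 0 ≤ s ^ 2 * ‖p‖ ^ 2 - 2 * s * inner ℝ p (g - p) := by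
    intro s hs
    have h1 := h.2 _ (hT p h.1 (1 + s) (by linarith))
    have h2 : g - (1 + s) • p = (g - p) - s • p := by module
    rw [h2] at h1
    have h3 := pow_le_pow_left₀ (norm_nonneg _) h1 2
    rw [norm_sub_sq_real (g - p) (s • p), norm_smul, real_inner_smul_right, real_inner_comm,
      mul_pow, Real.norm_eq_abs, sq_abs] at h3
    linarith
  set c := inner ℝ p (g - p)
  set a := ‖p‖ ^ 2
  have ha : 0 ≤ a := sq_nonneg _
  by_contra hc
  have hpos : 0 < a + |c| + 1 := by positivity
  have hcabs : |c| ≤ a + |c| + 1 := by linarith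
  -- The quadratic `s²a - 2sc` is tested at a small `s` of the sign of `c`; the denominator makes it
  -- negative while keeping `1 + s ≥ 0`.
  have hs : -1 ≤ c / (a + |c| + 1) := by
    rw [le_div_iff₀ hpos]; linarith [neg_abs_le c]
  have := key _ hs
  have h5 : (c / (a + |c| + 1)) ^ 2 * a - 2 * (c / (a + |c| + 1)) * c =
      (c / (a + |c| + 1)) ^ 2 * (a - 2 * (a + |c| + 1)) := by
    field_simp
  rw [h5] at this
  have h6 : 0 < (c / (a + |c| + 1)) ^ 2 := by positivity
  have h7 := nonneg_of_mul_nonneg_right this h6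
  linarith [abs_nonneg c]

variable [FiniteDimensional ℝ E]

theorem isNearest_metricProj_descentCone (f : E → ℝ) (z g : E) :
    IsNearest (descentCone f z) g (metricProj (descentCone f z) g) :=
  isNearest_metricProj (isClosed_descentCone f z) ⟨0, zero_mem_descentCone f z⟩ g

theorem inner_metricProj_descentCone (f : E → ℝ) (z g : E) :
    inner ℝ (metricProj (descentCone f z) g) (g - metricProj (descentCone f z) g) = 0 :=
  (isNearest_metricProj_descentCone f z g).inner_sub_eq_zero fun _ hx _ ht =>
    smul_mem_descentCone hx ht

/-- Pythagoras. The distance function is continuous, so this yields continuity, hence measurability,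
of the integrand although `metricProj` is defined by choice. -/
theorem sqNormProj_eq (f : E → ℝ) (z g : E) :
    sqNormProj f z g = ‖g‖ ^ 2 - Metric.infDist g (descentCone f z) ^ 2 := by
  set p := metricProj (descentCone f z) g with hp
  have hn := isNearest_metricProj_descentCone f z g
  have hd : Metric.infDist g (descentCone f z) = ‖g - p‖ := by
    refine le_antisymm ?_ ?_
    · rw [← dist_eq_norm]; exact Metric.infDist_le_dist_of_mem hn.1
    · refine (Metric.le_infDist ⟨_, hn.1⟩).2 fun {y} hy => ?_
      rw [dist_eq_norm]; exact hn.2 y hy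
  have h0 := inner_metricProj_descentCone f z g
  have h1 : ‖g‖ ^ 2 = ‖p‖ ^ 2 + ‖g - p‖ ^ 2 := by
    have := norm_add_sq_real p (g - p)
    rw [h0, add_sub_cancel] at this
    linarith
  rw [hd, h1, sqNormProj]
  ring

theorem continuous_sqNormProj (f : E → ℝ) (z : E) : Continuous (sqNormProj f z) := by
  rw [show sqNormProj f z = _ from funext (sqNormProj_eq f z)]
  have := Metric.continuous_infDist_pt (descentCone f z)
  fun_prop

/-- With `p` the projection, `‖p‖² = ⟪p, g⟫ ≤ ⟪p, g - y⟫ ≤ ‖p‖ ‖g - y‖`, because `⟪p, y⟫ ≤ 0` for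
`y` in the normal cone. -/
theorem norm_metricProj_descentCone_le {f : E → ℝ} {z y : E}
    (hy : ∀ x, f x ≤ f z → inner ℝ x y ≤ inner ℝ z y) (g : E) :
    ‖metricProj (descentCone f z) g‖ ≤ ‖g - y‖ := by
  set p := metricProj (descentCone f z) g
  have h0 := inner_metricProj_descentCone f z g
  have h1 : inner ℝ p y ≤ 0 :=
    inner_nonpos_of_mem_descentCone hy (isNearest_metricProj_descentCone f z g).1
  have h2 : ‖p‖ ^ 2 ≤ ‖p‖ * ‖g - y‖ := by
    rw [inner_sub_right, real_inner_self_eq_norm_sq] at h0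
    have := real_inner_le_norm p (g - y)
    rw [inner_sub_right] at this
    linarith
  rcases (norm_nonneg p).eq_or_lt with h | h
  · rw [← h]; positivity
  · rw [sq] at h2
    exact le_of_mul_le_mul_left h2 h

variable [MeasurableSpace E] [BorelSpace E]

/-- If the normal cone of `f` at `z` has Gaussian measure at least `1 / N`, then the statistical
dimension of `f` at `z` is at most `4 log N`. -/
theorem integrable_sqNormProj_and_statDim_le {f : E → ℝ} {z : E} {K : Set E}
    (hKm : MeasurableSet K) (hK : ∀ y ∈ K, ∀ x, f x ≤ f z → inner ℝ x y ≤ inner ℝ z y)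
    {N : ℝ} (hN : 0 < N) (hNK : 1 ≤ ENNReal.ofReal N * stdGaussian E K) :
    Integrable (sqNormProj f z) (stdGaussian E) ∧ statDim f z ≤ 4 * Real.log N := by
  have hcont := continuous_sqNormProj f z
  set γ := stdGaussian E
  have hint2 : MeasureTheory.Integrable (fun g : E => ‖g‖ ^ 2) γ :=
    (IsGaussian.memLp_two_id (μ := γ)).integrable_norm_pow (by norm_num)
  have hint : Integrable (sqNormProj f z) γ := by
    refine hint2.mono' hcont.aestronglyMeasurable (.of_forall fun g => ?_)
    rw [Real.norm_eq_abs, abs_of_nonneg (show 0 ≤ sqNormProj f z g from sq_nonneg _),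
      sqNormProj_eq]
    linarith [sq_nonneg (Metric.infDist g (descentCone f z))]
  refine ⟨hint, ?_⟩
  have hτ := stdGaussian_lintegral_mul_le_one (E := E)
    (f := fun g => ENNReal.ofReal (Real.exp (sqNormProj f z g / 4))) (g := K.indicator 1)
    (by fun_prop) (measurable_one.indicator hKm) fun x y => by
      by_cases hy : y ∈ K
      · rw [indicator_of_mem hy, Pi.one_apply, mul_one]
        have := norm_metricProj_descentCone_le (hK y hy) x
        rw [sqNormProj]
        gcongr
      · rw [indicator_of_notMem hy, mul_zero]; exact zero_le
  rw [lintegral_indicator_one hKm] at hτ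
  have hle : ∫⁻ g, ENNReal.ofReal (Real.exp (sqNormProj f z g / 4)) ∂γ ≤ ENNReal.ofReal N := by
    calc ∫⁻ g, ENNReal.ofReal (Real.exp (sqNormProj f z g / 4)) ∂γ
        ≤ (∫⁻ g, ENNReal.ofReal (Real.exp (sqNormProj f z g / 4)) ∂γ) *
          (ENNReal.ofReal N * γ K) := le_mul_of_one_le_right' hNK
      _ = ENNReal.ofReal N *
          ((∫⁻ g, ENNReal.ofReal (Real.exp (sqNormProj f z g / 4)) ∂γ) * γ K) := by ring
      _ ≤ ENNReal.ofReal N * 1 := by gcongr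
      _ = _ := mul_one _
  have hexpm : AEStronglyMeasurable (fun g => Real.exp (sqNormProj f z g / 4)) γ :=
    (by fun_prop : Continuous fun g => Real.exp (sqNormProj f z g / 4)).aestronglyMeasurable
  have hexp0 : 0 ≤ᵐ[γ] fun g => Real.exp (sqNormProj f z g / 4) :=
    .of_forall fun g => (Real.exp_pos _).le
  have hexpint : Integrable (fun g => Real.exp (sqNormProj f z g / 4)) γ := by
    refine ⟨hexpm, ?_⟩
    rw [hasFiniteIntegral_iff_ofReal hexp0]
    exact hle.trans_lt ENNReal.ofReal_lt_top
  have hexple : ∫ g, Real.exp (sqNormProj f z g / 4) ∂γ ≤ N := by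
    rw [integral_eq_lintegral_of_nonneg_ae hexp0 hexpm]
    exact ENNReal.toReal_le_of_le_ofReal hN.le hle
  -- Jensen's inequality in pointwise form: the tangent line of `exp` at `0`, evaluated at
  -- `sqNormProj f z g / 4 - log N`.
  have hpt : ∀ g, sqNormProj f z g ≤
      4 * (Real.log N - 1) + 4 * N⁻¹ * Real.exp (sqNormProj f z g / 4) := by
    intro g
    have := Real.add_one_le_exp (sqNormProj f z g / 4 - Real.log N)
    rw [Real.exp_sub, Real.exp_log hN, div_eq_inv_mul (Real.exp _) N] at this
    linarith
  calc statDim f z ≤ ∫ g, (4 * (Real.log N - 1) +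
        4 * N⁻¹ * Real.exp (sqNormProj f z g / 4)) ∂γ :=
        integral_mono hint ((integrable_const _).add (hexpint.const_mul _)) hpt
    _ = 4 * (Real.log N - 1) + 4 * N⁻¹ * ∫ g, Real.exp (sqNormProj f z g / 4) ∂γ := by
        rw [integral_add (integrable_const _) (hexpint.const_mul _), 
          integral_const_mul (4 * N⁻¹)]
        simp
    _ ≤ 4 * (Real.log N - 1) + 4 * N⁻¹ * N := by gcongr
    _ = 4 * Real.log N := by field_simp; ring

end Cone

/-! ### Normal cones of a vertex-transitive polytope -/

section NormalCone

variable {E : Type*} [NormedAddCommGroup E] [InnerProductSpace ℝ E]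

theorem inner_le_of_mem_convexHull {𝒜 : Set E} {c : ℝ} {y : E}
    (h : ∀ x ∈ 𝒜, inner ℝ x y ≤ c) {x : E} (hx : x ∈ convexHull ℝ 𝒜) : inner ℝ x y ≤ c := by
  have hconv : Convex ℝ {x : E | inner ℝ x y ≤ c} :=
    convex_halfSpace_le ⟨fun _ _ => inner_add_left _ _ _,
      fun _ _ => by rw [real_inner_smul_left, smul_eq_mul]⟩ c
  exact convexHull_min h hconv hx

variable [FiniteDimensional ℝ E] [MeasurableSpace E] [BorelSpace E]

/-- The normal cones at the points of a finite set on which the isometries act transitively tile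
the space, and have equal Gaussian measure. -/
theorem one_le_card_mul_stdGaussian_normalCone (𝒜 : Finset E)
    (htrans : ∀ v ∈ 𝒜, ∀ w ∈ 𝒜, ∃ φ : E ≃ₗᵢ[ℝ] E, (∀ x, φ x ∈ 𝒜 ↔ x ∈ 𝒜) ∧ φ v = w)
    {v : E} (hv : v ∈ 𝒜) :
    1 ≤ (𝒜.card : ℝ≥0∞) * stdGaussian E {y | ∀ x ∈ 𝒜, inner ℝ x y ≤ inner ℝ v y} := by
  set K : E → Set E := fun v => {y | ∀ x ∈ 𝒜, inner ℝ x y ≤ inner ℝ v y} with hK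
  have hKc : ∀ v, IsClosed (K v) := fun v => by
    have : K v = ⋂ x ∈ 𝒜, {y | inner ℝ x y ≤ inner ℝ v y} := by ext; simp [hK]
    rw [this]
    exact isClosed_biInter fun x _ => isClosed_le (by fun_prop) (by fun_prop)
  -- Each linear functional attains its maximum over `𝒜` at some atom. Covering suffices: overlaps
  -- are harmless for a lower bound.
  have hcover : (univ : Set E) ⊆ ⋃ w ∈ 𝒜, K w := fun y _ => by
    obtain ⟨w, hw, hmax⟩ := 𝒜.exists_max_image (fun x => inner ℝ x y) ⟨v, hv⟩
    exact mem_iUnion₂.2 ⟨w, hw, hmax⟩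
  have heq : ∀ w ∈ 𝒜, stdGaussian E (K w) = stdGaussian E (K v) := by
    intro w hw
    obtain ⟨φ, hφ, rfl⟩ := htrans v hv w hw
    conv_lhs => rw [← stdGaussian_map φ]
    rw [Measure.map_apply φ.continuous.measurable (hKc _).measurableSet]
    congr 1
    ext y
    constructor
    · intro h x hx
      have := h (φ x) ((hφ x).2 hx)
      rwa [φ.inner_map_map, φ.inner_map_map] at this
    · intro h x hx
      obtain ⟨x, rfl⟩ := φ.surjective x
      rw [φ.inner_map_map, φ.inner_map_map]
      exact h x ((hφ x).1 hx)
  calc (1 : ℝ≥0∞) = stdGaussian E univ := measure_univ.symm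
    _ ≤ stdGaussian E (⋃ w ∈ 𝒜, K w) := measure_mono hcover
    _ ≤ ∑ w ∈ 𝒜, stdGaussian E (K w) := measure_biUnion_finset_le _ _
    _ = 𝒜.card * stdGaussian E (K v) := by
      rw [Finset.sum_congr rfl heq, Finset.sum_const, nsmul_eq_mul]

/-- The statistical dimension of the gauge of a vertex-transitive polytope with `N` vertices is at
most `4 log N` at each vertex. -/
theorem integrable_sqNormProj_atomicNorm_and_statDim_le (𝒜 : Finset E)
    (htrans : ∀ v ∈ 𝒜, ∀ w ∈ 𝒜, ∃ φ : E ≃ₗᵢ[ℝ] E, (∀ x, φ x ∈ 𝒜 ↔ x ∈ 𝒜) ∧ φ v = w)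
    (hsub : {x | atomicNorm (𝒜 : Set E) x ≤ 1} = convexHull ℝ (𝒜 : Set E))
    {v : E} (hv : v ∈ 𝒜) :
    Integrable (sqNormProj (atomicNorm (𝒜 : Set E)) v) (stdGaussian E) ∧
      statDim (atomicNorm (𝒜 : Set E)) v ≤ 4 * Real.log 𝒜.card := by
  have hcard : 0 < 𝒜.card := Finset.card_pos.2 ⟨v, hv⟩
  refine integrable_sqNormProj_and_statDim_le
    (K := {y | ∀ x ∈ 𝒜, inner ℝ x y ≤ inner ℝ v y}) ?_ ?_ (by exact_mod_cast hcard) ?_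
  · have : {y : E | ∀ x ∈ 𝒜, inner ℝ x y ≤ inner ℝ v y} =
        ⋂ x ∈ 𝒜, {y | inner ℝ x y ≤ inner ℝ v y} := by ext; simp
    rw [this]
    exact (isClosed_biInter fun x _ => isClosed_le (by fun_prop) (by fun_prop)).measurableSet
  · intro y hy x hx
    have h1 : atomicNorm (𝒜 : Set E) v ≤ 1 :=
      gauge_le_one_of_mem (subset_convexHull ℝ _ (Finset.mem_coe.2 hv))
    have h2 : x ∈ convexHull ℝ (𝒜 : Set E) := by rw [← hsub]; exact hx.trans h1
    exact inner_le_of_mem_convexHull (fun x hx => hy x (Finset.mem_coe.1 hx)) h2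
  · rw [ENNReal.ofReal_natCast]
    exact one_le_card_mul_stdGaussian_normalCone 𝒜 htrans hv

end NormalCone

/-! ### Unit balls, extreme points and signed permutations -/

section Polytope

theorem setOf_atomicNorm_le_one {E : Type*} [NormedAddCommGroup E] [NormedSpace ℝ E]
    {𝒜 : Set E} (hfin : 𝒜.Finite) (h0 : convexHull ℝ 𝒜 ∈ nhds 0) :
    {x | atomicNorm 𝒜 x ≤ 1} = convexHull ℝ 𝒜 := by
  ext x
  rw [mem_ofPred_eq, atomicNorm, gauge_le_one_iff_mem_closure (convex_convexHull ℝ 𝒜) h0,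
    (hfin.isClosed_convexHull ℝ).closure_eq]

/-- Points of the unit sphere are extreme in the closed ball by strict convexity, hence in any
subset of the ball containing them. -/
theorem extremePoints_convexHull_eq_of_norm_eq_one {E : Type*} [NormedAddCommGroup E]
    [InnerProductSpace ℝ E] {𝒜 : Set E} (h : ∀ x ∈ 𝒜, ‖x‖ = 1) :
    extremePoints ℝ (convexHull ℝ 𝒜) = 𝒜 := by
  refine subset_antisymm extremePoints_convexHull_subset fun x hx => ?_
  have hsub : convexHull ℝ 𝒜 ⊆ Metric.closedBall 0 1 :=
    convexHull_min (fun y hy => by simp [h y hy]) (convex_closedBall _ _)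
  refine inter_extremePoints_subset_extremePoints_of_subset hsub
    ⟨subset_convexHull ℝ _ hx, ?_⟩
  exact StrictConvexSpace.sphere_subset_extremePoints_closedBall 0 one_ne_zero
    (mem_sphere_zero_iff_norm.2 (h x hx))

/-- A small `z` is the average of the `n` axis vectors with entries `n * z i`, each on a segment
between `±r` times a basis vector; a ball of radius `r / n` therefore fits. -/
theorem convex_mem_nhds_zero_of_single_mem {ι : Type*} [Fintype ι] [DecidableEq ι]
    {S : Set (EuclideanSpace ℝ ι)} (hS : Convex ℝ S) (hne : S.Nonempty) {r : ℝ} (hr : 0 < r)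
    (h : ∀ i, EuclideanSpace.single i r ∈ S ∧ EuclideanSpace.single i (-r) ∈ S) :
    S ∈ nhds 0 := by
  rcases isEmpty_or_nonempty ι with hι | hι
  · have : S = univ := by
      obtain ⟨x, hx⟩ := hne
      exact eq_univ_of_forall fun y => by rwa [Subsingleton.elim y x]
    rw [this]; exact Filter.univ_mem
  have hseg : ∀ i (t : ℝ), |t| ≤ r → EuclideanSpace.single i t ∈ S := by
    intro i t ht
    rw [abs_le] at ht
    have := hS (h i).1 (h i).2 (a := (r + t) / (2 * r)) (b := (r - t) / (2 * r))
      (div_nonneg (by linarith) (by linarith)) (div_nonneg (by linarith) (by linarith))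
      (by field_simp; ring)
    convert this using 1
    ext j
    by_cases hj : j = i
    · subst hj
      simp
      field_simp
      ring
    · simp [hj]
  set n : ℝ := (Fintype.card ι : ℝ) with hn'
  have hn : 0 < n := by rw [hn']; exact_mod_cast Fintype.card_pos (α := ι)
  refine Filter.mem_of_superset (Metric.closedBall_mem_nhds 0 (div_pos hr hn)) fun z hz => ?_
  have hz' : ‖z‖ ≤ r / n := by simpa using hz
  have hsum : z = ∑ i, n⁻¹ • EuclideanSpace.single i (n * z i) := by
    ext j
    simp [Finset.sum_apply, Pi.single_apply, hn.ne']
  rw [hsum]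
  refine hS.sum_mem (fun _ _ => (inv_pos.2 hn).le) ?_ fun i _ => hseg i _ ?_
  · simp [n]
  · rw [abs_mul, abs_of_pos hn]
    have := (PiLp.norm_apply_le z i).trans hz'
    rw [Real.norm_eq_abs, le_div_iff₀ hn] at this
    linarith

theorem exists_signedPerm {ι : Type*} [Fintype ι] (e : Equiv.Perm ι) (s : ι → ℝ)
    (hs : ∀ i, s i = 1 ∨ s i = -1) :
    ∃ φ : EuclideanSpace ℝ ι ≃ₗᵢ[ℝ] EuclideanSpace ℝ ι, ∀ x i, φ x i = s i * x (e i) := by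
  classical
  refine ⟨(LinearIsometryEquiv.piLpCongrLeft 2 ℝ ℝ e.symm).trans
    (LinearIsometryEquiv.piLpCongrRight 2 fun i =>
      if s i = 1 then LinearIsometryEquiv.refl ℝ ℝ else LinearIsometryEquiv.neg ℝ), fun x i => ?_⟩
  rcases hs i with h | h
  · simp [h, LinearIsometryEquiv.piLpCongrLeft_apply, Equiv.piCongrLeft'_apply]
  · have : ¬ ((-1 : ℝ) = 1) := by norm_num
    simp [h, this, LinearIsometryEquiv.piLpCongrLeft_apply, Equiv.piCongrLeft'_apply]

end Polytope

/-! ### Flat vectors: counting and symmetries -/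

section FlatVec

variable {m k : ℕ}

theorem one_div_sqrt_pos (hk : 1 ≤ k) : 0 < 1 / Real.sqrt k := by
  have : (0 : ℝ) < k := by exact_mod_cast hk
  positivity

theorem sum_sq_of_mem_flatVec (hk : 1 ≤ k) {a : Fin m → ℝ} (ha : a ∈ flatVec m k) :
    ∑ i, a i ^ 2 = 1 := by
  have hk0 : (0 : ℝ) < k := by exact_mod_cast hk
  have : ∀ i, a i ^ 2 = if a i ≠ 0 then 1 / (k : ℝ) else 0 := by
    intro i
    split_ifs with h
    · rw [← sq_abs, ha.2 i h, div_pow, one_pow, Real.sq_sqrt hk0.le]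
    · rw [not_not] at h; simp [h]
  rw [Finset.sum_congr rfl fun i _ => this i, ← Finset.sum_filter, Finset.sum_const, nsmul_eq_mul]
  have hc : (Finset.univ.filter fun i => a i ≠ 0).card = k := ha.1
  rw [hc]
  field_simp

/-- The flat vector with support `s` that is positive exactly on `t`. -/
noncomputable def flatFun (m k : ℕ) (s t : Finset (Fin m)) : Fin m → ℝ := fun i =>
  if i ∈ s then if i ∈ t then 1 / Real.sqrt k else -(1 / Real.sqrt k) else 0

theorem flatFun_ne_zero_iff (hk : 1 ≤ k) {s t : Finset (Fin m)} {i : Fin m} :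
    flatFun m k s t i ≠ 0 ↔ i ∈ s := by
  have := (one_div_sqrt_pos hk).ne'
  unfold flatFun
  split_ifs <;> simp_all

theorem flatFun_mem (hk : 1 ≤ k) {s : Finset (Fin m)} (hs : s.card = k) (t : Finset (Fin m)) :
    flatFun m k s t ∈ flatVec m k := by
  refine ⟨?_, fun i hi => ?_⟩
  · rw [hammingNorm, ← hs]
    congr 1
    ext i
    rw [Finset.mem_filter, hs, flatFun_ne_zero_iff hk]
    simp
  · rw [flatFun_ne_zero_iff hk] at hi
    have := (one_div_sqrt_pos hk).le
    rw [flatFun, if_pos hi]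
    split_ifs
    · exact abs_of_nonneg this
    · rw [abs_neg, abs_of_nonneg this]

theorem neg_mem_flatVec {a : Fin m → ℝ} (ha : a ∈ flatVec m k) : -a ∈ flatVec m k :=
  ⟨by simpa [hammingNorm] using ha.1, fun i hi => by
    rw [Pi.neg_apply, abs_neg]; exact ha.2 i (by simpa using hi)⟩

/-- The flat vectors, as a finite set. -/
noncomputable def flatFinset (m k : ℕ) : Finset (Fin m → ℝ) := by
  classical
  exact ((Finset.univ.powersetCard k).sigma fun s => s.powerset).image fun p =>
    flatFun m k p.1 p.2

theorem coe_flatFinset (hk : 1 ≤ k) : (flatFinset m k : Set (Fin m → ℝ)) = flatVec m k := by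
  classical
  ext a
  simp only [flatFinset, Finset.coe_image, Finset.coe_sigma, mem_image]
  constructor
  · rintro ⟨⟨s, t⟩, h, rfl⟩
    simp at h
    exact flatFun_mem hk h.1 t
  · intro ha
    refine ⟨⟨Finset.univ.filter fun i => a i ≠ 0, Finset.univ.filter fun i => 0 < a i⟩, ?_, ?_⟩
    · simp only [mem_sigma_iff, Finset.mem_coe, Finset.mem_powersetCard, Finset.mem_powerset]
      refine ⟨⟨Finset.subset_univ _, ha.1⟩, fun i hi => ?_⟩
      simp only [Finset.mem_filter, Finset.mem_univ, true_and] at hi ⊢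
      exact hi.ne'
    · ext i
      simp only [flatFun, Finset.mem_filter, Finset.mem_univ, true_and]
      split_ifs with h1 h2
      · rw [← ha.2 i h1, abs_of_pos h2]
      · rw [← ha.2 i h1, abs_of_nonpos (not_lt.1 h2), neg_neg]
      · rw [not_not] at h1; exact h1.symm

/-- A flat vector amounts to a support `s` of size `k` and a positive part `t`; requiring `t ⊆ s`
makes the parametrization injective. -/
theorem card_flatFinset (hk : 1 ≤ k) : (flatFinset m k).card = 2 ^ k * m.choose k := by
  classical
  rw [flatFinset, Finset.card_image_of_injOn, Finset.card_sigma,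
    Finset.sum_congr rfl fun s hs => by
      rw [Finset.card_powerset, (Finset.mem_powersetCard.1 hs).2], Finset.sum_const,
    Finset.card_powersetCard, Finset.card_univ, Fintype.card_fin, smul_eq_mul, mul_comm]
  rintro ⟨s, t⟩ h ⟨s', t'⟩ h' heq
  simp only [Finset.coe_sigma, mem_sigma_iff, Finset.mem_coe, Finset.mem_powerset] at h h' heq
  have hs : s = s' := by
    ext i
    rw [← flatFun_ne_zero_iff (t := t) hk, heq, flatFun_ne_zero_iff hk]
  subst hs
  have hpos := one_div_sqrt_pos hk
  have ht : t = t' := by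
    ext i
    by_cases hi : i ∈ s
    · have := congrFun heq i
      simp only [flatFun, if_pos hi] at this
      split_ifs at this with h1 h2 h2
      · simp [h1, h2]
      · linarith
      · linarith
      · simp [h1, h2]
    · exact ⟨fun h1 => absurd (h.2 h1) hi, fun h1 => absurd (h'.2 h1) hi⟩
  rw [ht]

/-- Two vectors with the same support `s ∋ i`, one positive on all of `s` and one only at `i`,
cancel away from `i`. This serves to place multiples of matrix units in the hull of the atoms. -/
theorem exists_flatVec_add_eq_single (hk : 1 ≤ k) (hkm : k ≤ m) (i : Fin m) :
    ∃ a ∈ flatVec m k, ∃ a' ∈ flatVec m k,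
      ∀ j, a j + a' j = if j = i then 2 * (1 / Real.sqrt k) else 0 := by
  obtain ⟨s, his, -, hs⟩ := Finset.exists_subsuperset_card_eq (Finset.subset_univ {i})
    (by simpa using hk) (by simpa using hkm)
  rw [Finset.singleton_subset_iff] at his
  refine ⟨_, flatFun_mem hk hs s, _, flatFun_mem hk hs {i}, fun j => ?_⟩
  by_cases hj : j = i
  · subst hj
    simp [flatFun, his]
    ring
  · by_cases hjs : j ∈ s <;> simp [flatFun, hj, hjs]

/-- The supports have equal size, so a bijection between them extends to a permutation; the moduli
then agree and only signs remain. -/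
theorem exists_perm_sign_of_mem_flatVec {a a' : Fin m → ℝ} (ha : a ∈ flatVec m k)
    (ha' : a' ∈ flatVec m k) :
    ∃ (σ : Equiv.Perm (Fin m)) (ε : Fin m → ℝ), (∀ i, ε i = 1 ∨ ε i = -1) ∧
      ∀ i, ε i * a (σ i) = a' i := by
  have hcard : Fintype.card {i // a' i ≠ 0} = Fintype.card {i // a i ≠ 0} := by
    rw [Fintype.card_subtype, Fintype.card_subtype]
    exact ha'.1.trans ha.1.symm
  let σ := (Fintype.equivOfCardEq hcard).extendSubtype
  have key : ∀ i, ∃ s : ℝ, (s = 1 ∨ s = -1) ∧ s * a (σ i) = a' i := by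
    intro i
    by_cases hi : a' i = 0
    · have : ¬ a (σ i) ≠ 0 :=
        (Fintype.equivOfCardEq hcard).extendSubtype_not_mem i (not_not.2 hi)
      rw [not_not] at this
      exact ⟨1, .inl rfl, by rw [this, hi, mul_zero]⟩
    · have : a (σ i) ≠ 0 := (Fintype.equivOfCardEq hcard).extendSubtype_mem i hi
      have h2 := (ha.2 _ this).trans (ha'.2 _ hi).symm
      rcases abs_eq_abs.1 h2 with h | h
      · exact ⟨1, .inl rfl, by rw [h, one_mul]⟩
      · exact ⟨-1, .inr rfl, by rw [h]; ring⟩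
  choose ε hε using key
  exact ⟨σ, ε, fun i => (hε i).1, fun i => (hε i).2⟩

theorem signedPerm_mem_flatVec {a : Fin m → ℝ} (ha : a ∈ flatVec m k) (σ : Equiv.Perm (Fin m))
    {ε : Fin m → ℝ} (hε : ∀ i, ε i = 1 ∨ ε i = -1) :
    (fun i => ε i * a (σ i)) ∈ flatVec m k := by
  have habs : ∀ i, |ε i * a (σ i)| = |a (σ i)| := fun i => by
    rcases hε i with h | h <;> simp [h]
  have hne : ∀ i, ε i * a (σ i) ≠ 0 ↔ a (σ i) ≠ 0 := fun i => by
    rw [← abs_pos, habs, abs_pos]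
  refine ⟨?_, fun i hi => ?_⟩
  · rw [← ha.1, hammingNorm, hammingNorm]
    refine Finset.card_bij (fun i _ => σ i) (fun i hi => ?_) (fun _ _ _ _ h => σ.injective h)
      fun i hi => ⟨σ.symm i, ?_, σ.apply_symm_apply i⟩
    · simpa only [Finset.mem_filter, Finset.mem_univ, true_and, hne] using hi
    · simpa only [Finset.mem_filter, Finset.mem_univ, true_and, hne, σ.apply_symm_apply] using hi
  · rw [habs]; exact ha.2 _ ((hne i).1 hi)

theorem exists_ne_zero_of_mem_flatVec (hk : 1 ≤ k) {a : Fin m → ℝ} (ha : a ∈ flatVec m k) :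
    ∃ i, a i ≠ 0 := by
  by_contra! h
  have := sum_sq_of_mem_flatVec hk ha
  simp [h] at this

end FlatVec

/-! ### Atoms of the CUT norm: position, number and transitivity -/

section CutAtoms

variable {m₁ m₂ k q : ℕ}

theorem norm_eq_one_of_mem_cutAtoms (hk : 1 ≤ k) (hq : 1 ≤ q) {A : RMat m₁ m₂}
    (hA : A ∈ cutAtoms m₁ m₂ k q) : ‖A‖ = 1 := by
  obtain ⟨a, ha, b, hb, rfl⟩ := hA
  rw [EuclideanSpace.norm_eq, Real.sqrt_eq_one, Fintype.sum_prod_type]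
  simp only [outer, Real.norm_eq_abs, sq_abs, mul_pow]
  rw [← Finset.sum_mul_sum, sum_sq_of_mem_flatVec hk ha, sum_sq_of_mem_flatVec hq hb, one_mul]

theorem single_mem_convexHull_cutAtoms (hk : 1 ≤ k) (hkm : k ≤ m₁) (hq : 1 ≤ q) (hqm : q ≤ m₂)
    (p : Fin m₁ × Fin m₂) :
    EuclideanSpace.single p (1 / Real.sqrt k * (1 / Real.sqrt q)) ∈
        convexHull ℝ (cutAtoms m₁ m₂ k q) ∧
      EuclideanSpace.single p (-(1 / Real.sqrt k * (1 / Real.sqrt q))) ∈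
        convexHull ℝ (cutAtoms m₁ m₂ k q) := by
  have hconv := convex_convexHull ℝ (cutAtoms m₁ m₂ k q)
  have hmem : ∀ a ∈ flatVec m₁ k, ∀ b ∈ flatVec m₂ q,
      outer a b ∈ convexHull ℝ (cutAtoms m₁ m₂ k q) := fun a ha b hb =>
    subset_convexHull ℝ _ ⟨a, ha, b, hb, rfl⟩
  -- By bilinearity this matrix is the average of the four atoms obtained by expanding the product.
  have h4 : ∀ a ∈ flatVec m₁ k, ∀ a' ∈ flatVec m₁ k, ∀ b ∈ flatVec m₂ q, ∀ b' ∈ flatVec m₂ q,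
      (1 / 4 : ℝ) • outer (a + a') (b + b') ∈ convexHull ℝ (cutAtoms m₁ m₂ k q) := by
    intro a ha a' ha' b hb b' hb'
    have h2 : (0 : ℝ) ≤ 1 / 2 := by norm_num
    have := hconv (hconv (hmem a ha b hb) (hmem a ha b' hb') h2 h2 (by norm_num))
      (hconv (hmem a' ha' b hb) (hmem a' ha' b' hb') h2 h2 (by norm_num)) h2 h2 (by norm_num)
    convert this using 1
    ext x
    simp only [outer, PiLp.smul_apply, PiLp.add_apply, Pi.add_apply, smul_eq_mul]
    ring
  obtain ⟨a, ha, a', ha', haa⟩ := exists_flatVec_add_eq_single hk hkm p.1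
  obtain ⟨b, hb, b', hb', hbb⟩ := exists_flatVec_add_eq_single hq hqm p.2
  constructor
  · convert h4 a ha a' ha' b hb b' hb' using 1
    ext x
    by_cases h1 : x.1 = p.1 <;> by_cases h2 : x.2 = p.2 <;>
      simp [outer, haa, hbb, h1, h2, Prod.ext_iff]
    ring
  · convert h4 _ (neg_mem_flatVec ha) _ (neg_mem_flatVec ha') b hb b' hb' using 1
    ext x
    have haa' : ∀ j, (-a) j + (-a') j = if j = p.1 then -(2 * (1 / Real.sqrt k)) else 0 := by
      intro j
      rw [Pi.neg_apply, Pi.neg_apply, ← neg_add, haa]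
      split_ifs <;> simp
    by_cases h1 : x.1 = p.1 <;> by_cases h2 : x.2 = p.2 <;>
      simp [outer, haa', hbb, h1, h2, Prod.ext_iff, -Pi.neg_apply]
    ring

/-- All non-zero entries of `a` and `a'` share one modulus, so the usual scaling ambiguity of a
rank-one factorization reduces to a common sign. -/
theorem outer_eq_outer_iff (hk : 1 ≤ k) (hq : 1 ≤ q) {a a' : Fin m₁ → ℝ} {b b' : Fin m₂ → ℝ}
    (ha : a ∈ flatVec m₁ k) (ha' : a' ∈ flatVec m₁ k) (hb : b ∈ flatVec m₂ q) :
    outer a' b' = outer a b ↔ (a' = a ∧ b' = b) ∨ (a' = -a ∧ b' = -b) := by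
  constructor
  · intro h
    have hp : ∀ i j, a' i * b' j = a i * b j := fun i j =>
      congrArg (fun Z : RMat m₁ m₂ => Z (i, j)) h
    obtain ⟨i, hi⟩ := exists_ne_zero_of_mem_flatVec hk ha
    obtain ⟨j, hj⟩ := exists_ne_zero_of_mem_flatVec hq hb
    have hi' : a' i ≠ 0 := left_ne_zero_of_mul (hp i j ▸ mul_ne_zero hi hj)
    rcases abs_eq_abs.1 ((ha'.2 i hi').trans (ha.2 i hi).symm) with h1 | h1
    · have hb' : b' = b := funext fun j => mul_left_cancel₀ hi (h1 ▸ hp i j)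
      exact .inl ⟨funext fun i => mul_right_cancel₀ hj (hb' ▸ hp i j), hb'⟩
    · have hb' : b' = -b := funext fun j => mul_left_cancel₀ hi (by
        have := hp i j
        rw [h1] at this
        simp only [Pi.neg_apply]
        linarith)
      refine .inr ⟨funext fun i => mul_right_cancel₀ hj ?_, hb'⟩
      have := hp i j
      rw [hb', Pi.neg_apply] at this
      simp only [Pi.neg_apply]
      linarith
  · rintro (⟨rfl, rfl⟩ | ⟨rfl, rfl⟩)
    · rfl
    · ext x; simp [outer]

/-- The atoms of the `(k,q)`-CUT norm, as a finite set. -/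
noncomputable def cutFinset (m₁ m₂ k q : ℕ) : Finset (RMat m₁ m₂) := by
  classical
  exact (flatFinset m₁ k ×ˢ flatFinset m₂ q).image fun p => outer p.1 p.2

theorem coe_cutFinset (hk : 1 ≤ k) (hq : 1 ≤ q) :
    (cutFinset m₁ m₂ k q : Set (RMat m₁ m₂)) = cutAtoms m₁ m₂ k q := by
  ext A
  simp only [cutFinset, Finset.coe_image, Finset.coe_product, coe_flatFinset hk, coe_flatFinset hq,
    mem_image, mem_prod, Prod.exists, cutAtoms, mem_ofPred_eq]
  constructor
  · rintro ⟨a, b, ⟨ha, hb⟩, rfl⟩; exact ⟨a, ha, b, hb, rfl⟩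
  · rintro ⟨a, ha, b, hb, rfl⟩; exact ⟨a, b, ⟨ha, hb⟩, rfl⟩

theorem card_cutFinset (hk : 1 ≤ k) (hq : 1 ≤ q) :
    (cutFinset m₁ m₂ k q).card = 2 ^ (k + q - 1) * m₁.choose k * m₂.choose q := by
  classical
  have hmem₁ : ∀ a, a ∈ flatFinset m₁ k ↔ a ∈ flatVec m₁ k := fun a => by
    rw [← Finset.mem_coe, coe_flatFinset hk]
  have hmem₂ : ∀ b, b ∈ flatFinset m₂ q ↔ b ∈ flatVec m₂ q := fun b => by
    rw [← Finset.mem_coe, coe_flatFinset hq]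
  have hfib := Finset.card_eq_sum_card_image (fun p : (Fin m₁ → ℝ) × (Fin m₂ → ℝ) =>
    outer p.1 p.2) (flatFinset m₁ k ×ˢ flatFinset m₂ q)
  have htwo : ∀ A ∈ (flatFinset m₁ k ×ˢ flatFinset m₂ q).image
      (fun p : (Fin m₁ → ℝ) × (Fin m₂ → ℝ) => outer p.1 p.2),
      ((flatFinset m₁ k ×ˢ flatFinset m₂ q).filter fun p => outer p.1 p.2 = A).card = 2 := by
    intro A hA
    obtain ⟨⟨a, b⟩, hab, rfl⟩ := Finset.mem_image.1 hA
    rw [Finset.mem_product, hmem₁, hmem₂] at hab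
    have hne : ((a, b) : (Fin m₁ → ℝ) × (Fin m₂ → ℝ)) ≠ (-a, -b) := by
      intro h
      obtain ⟨i, hi⟩ := exists_ne_zero_of_mem_flatVec hk hab.1
      have := congrFun (congrArg Prod.fst h) i
      simp only [Pi.neg_apply] at this
      exact hi (by linarith)
    rw [← Finset.card_pair hne]
    congr 1
    ext ⟨a', b'⟩
    rw [Finset.mem_filter, Finset.mem_product, hmem₁, hmem₂, Finset.mem_insert,
      Finset.mem_singleton, Prod.mk.injEq, Prod.mk.injEq]
    constructor
    · rintro ⟨h1, h2⟩
      exact (outer_eq_outer_iff hk hq hab.1 h1.1 hab.2).1 h2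
    · rintro (⟨rfl, rfl⟩ | ⟨rfl, rfl⟩)
      · exact ⟨hab, rfl⟩
      · have := neg_mem_flatVec hab.1
        exact ⟨⟨this, neg_mem_flatVec hab.2⟩,
          (outer_eq_outer_iff hk hq hab.1 this hab.2).2 (.inr ⟨rfl, rfl⟩)⟩
  rw [Finset.sum_congr rfl htwo, Finset.sum_const, Finset.card_product, card_flatFinset hk,
    card_flatFinset hq, smul_eq_mul] at hfib
  have hcard : (cutFinset m₁ m₂ k q).card = ((flatFinset m₁ k ×ˢ flatFinset m₂ q).image
      (fun p : (Fin m₁ → ℝ) × (Fin m₂ → ℝ) => outer p.1 p.2)).card := by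
    rw [cutFinset]
  rw [← hcard] at hfib
  -- Shifting `k` removes the truncated subtraction in the exponent, so the factor 2 from the
  -- two-element fibres can be cancelled.
  obtain ⟨k, rfl⟩ := Nat.exists_eq_add_of_le' hk
  rw [show k + 1 + q - 1 = k + q by omega]
  rw [pow_succ] at hfib
  refine Nat.eq_of_mul_eq_mul_right two_pos (hfib.symm.trans ?_)
  ring

theorem exists_isometry_cutFinset (hk : 1 ≤ k) (hq : 1 ≤ q) {v w : RMat m₁ m₂}
    (hv : v ∈ cutFinset m₁ m₂ k q) (hw : w ∈ cutFinset m₁ m₂ k q) :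
    ∃ φ : RMat m₁ m₂ ≃ₗᵢ[ℝ] RMat m₁ m₂,
      (∀ x, φ x ∈ cutFinset m₁ m₂ k q ↔ x ∈ cutFinset m₁ m₂ k q) ∧ φ v = w := by
  classical
  have hmem : ∀ A, A ∈ cutFinset m₁ m₂ k q ↔ A ∈ cutAtoms m₁ m₂ k q := fun A => by
    rw [← Finset.mem_coe, coe_cutFinset hk hq]
  obtain ⟨a, ha, b, hb, rfl⟩ := (hmem v).1 hv
  obtain ⟨a', ha', b', hb', rfl⟩ := (hmem w).1 hw
  obtain ⟨σ, ε, hε, hσ⟩ := exists_perm_sign_of_mem_flatVec ha ha'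
  obtain ⟨τ, δ, hδ, hτ⟩ := exists_perm_sign_of_mem_flatVec hb hb'
  obtain ⟨φ, hφ⟩ := exists_signedPerm (σ.prodCongr τ) (fun p => ε p.1 * δ p.2) fun p => by
    rcases hε p.1 with h | h <;> rcases hδ p.2 with h' | h' <;> simp [h, h']
  have houter : ∀ (c : Fin m₁ → ℝ) (d : Fin m₂ → ℝ), φ (outer c d) =
      outer (fun i => ε i * c (σ i)) (fun j => δ j * d (τ j)) := by
    intro c d
    ext p
    rw [hφ]
    simp only [outer, Equiv.prodCongr_apply, Prod.map_fst, Prod.map_snd]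
    ring
  -- An injective map of a finite set into itself is onto, so only one inclusion needs checking.
  have himg : (cutFinset m₁ m₂ k q).image φ = cutFinset m₁ m₂ k q := by
    refine Finset.eq_of_subset_of_card_le (fun x hx => ?_)
      (Finset.card_image_of_injective _ φ.injective).ge
    obtain ⟨y, hy, rfl⟩ := Finset.mem_image.1 hx
    obtain ⟨c, hc, d, hd, rfl⟩ := (hmem y).1 hy
    rw [hmem, houter]
    exact ⟨_, signedPerm_mem_flatVec hc σ hε, _, signedPerm_mem_flatVec hd τ hδ, rfl⟩
  refine ⟨φ, fun x => ?_, ?_⟩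
  · conv_lhs => rw [← himg]
    exact φ.injective.mem_finset_image
  · rw [houter, funext hσ, funext hτ]

end CutAtoms

/-! ### Numerical bound on the number of vertices and conclusion -/

section Main

/-- Combines `C(m, k) ≤ m^k / k!` with `k^k / k! ≤ e^k`, the latter being one term of the
exponential series. -/
theorem log_choose_le {m k : ℕ} (hk : 1 ≤ k) (hkm : k ≤ m) :
    Real.log (m.choose k) ≤ k + k * Real.log ((m : ℝ) / k) := by
  have hk0 : (0 : ℝ) < k := by exact_mod_cast hk
  have hm0 : (0 : ℝ) < m := by exact_mod_cast hk.trans hkm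
  have hc : (0 : ℝ) < m.choose k := by exact_mod_cast Nat.choose_pos hkm
  have h1 : (m.choose k : ℝ) ≤ (m : ℝ) ^ k / k.factorial := Nat.choose_le_pow_div k m
  have h2 : (k : ℝ) ^ k / k.factorial ≤ Real.exp k := Real.pow_div_factorial_le_exp _ hk0.le k
  have h3 : (m.choose k : ℝ) ≤ Real.exp k * ((m : ℝ) / k) ^ k := by
    calc (m.choose k : ℝ) ≤ (m : ℝ) ^ k / k.factorial := h1
      _ = (k : ℝ) ^ k / k.factorial * ((m : ℝ) / k) ^ k := by
        rw [div_pow]; field_simp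
      _ ≤ _ := by gcongr
  calc Real.log (m.choose k) ≤ Real.log (Real.exp k * ((m : ℝ) / k) ^ k) := Real.log_le_log hc h3
    _ = _ := by
      rw [Real.log_mul (Real.exp_pos _).ne' (by positivity), Real.log_exp, Real.log_pow]

/-- The estimates used already give constants 8 and 4 in place of 16 and 9; the non-negativity of
the logarithms, from `k ≤ m₁` and `q ≤ m₂`, absorbs the slack. -/
theorem four_mul_log_card_cutFinset_le {m₁ m₂ k q : ℕ} (hk : 1 ≤ k) (hkm : k ≤ m₁) (hq : 1 ≤ q)
    (hqm : q ≤ m₂) :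
    4 * Real.log (cutFinset m₁ m₂ k q).card ≤ 16 * ((k : ℝ) + q) +
      9 * (k * Real.log ((m₁ : ℝ) / k) + q * Real.log ((m₂ : ℝ) / q)) := by
  have hk0 : (0 : ℝ) < k := by exact_mod_cast hk
  have hq0 : (0 : ℝ) < q := by exact_mod_cast hq
  have hc₁ : (0 : ℝ) < m₁.choose k := by exact_mod_cast Nat.choose_pos hkm
  have hc₂ : (0 : ℝ) < m₂.choose q := by exact_mod_cast Nat.choose_pos hqm
  have hl₁ : 0 ≤ Real.log ((m₁ : ℝ) / k) :=
    Real.log_nonneg ((one_le_div hk0).2 (by exact_mod_cast hkm))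
  have hl₂ : 0 ≤ Real.log ((m₂ : ℝ) / q) :=
    Real.log_nonneg ((one_le_div hq0).2 (by exact_mod_cast hqm))
  have h1 := log_choose_le hk hkm
  have h2 := log_choose_le hq hqm
  have hlog2 : Real.log 2 ≤ 1 := by
    have := Real.log_le_sub_one_of_pos (x := 2) (by norm_num)
    linarith
  have h3 : ((k + q - 1 : ℕ) : ℝ) * Real.log 2 ≤ k + q := by
    calc ((k + q - 1 : ℕ) : ℝ) * Real.log 2 ≤ ((k + q : ℕ) : ℝ) * 1 := by
          gcongr
          omega
      _ = _ := by push_cast; ring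
  rw [card_cutFinset hk hq]
  push_cast
  rw [Real.log_mul (by positivity) hc₂.ne', Real.log_mul (by positivity) hc₁.ne', Real.log_pow]
  have h4 := mul_nonneg hk0.le hl₁
  have h5 := mul_nonneg hq0.le hl₂
  linarith

end Main

end SparseCut

theorem mainTheorem9 (m₁ m₂ k q : ℕ) (hk : 1 ≤ k) (hkm : k ≤ m₁) (hq : 1 ≤ q) (hqm : q ≤ m₂) :
    (∀ A ∈ SparseCut.cutAtoms m₁ m₂ k q,
      MeasureTheory.Integrable (SparseCut.sqNormProj (SparseCut.cutNorm m₁ m₂ k q) A)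
        (ProbabilityTheory.stdGaussian (SparseCut.RMat m₁ m₂)) ∧
      SparseCut.statDim (SparseCut.cutNorm m₁ m₂ k q) A ≤
        16 * ((k : ℝ) + q) +
          9 * (k * Real.log ((m₁ : ℝ) / k) + q * Real.log ((m₂ : ℝ) / q))) ∧
    SparseCut.IsVertexTransitivePolytope {Z | SparseCut.cutNorm m₁ m₂ k q Z ≤ 1} ∧
    Set.extremePoints ℝ {Z | SparseCut.cutNorm m₁ m₂ k q Z ≤ 1} =
      SparseCut.cutAtoms m₁ m₂ k q ∧
    (Set.extremePoints ℝ {Z | SparseCut.cutNorm m₁ m₂ k q Z ≤ 1}).ncard =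
      2 ^ (k + q - 1) * m₁.choose k * m₂.choose q := by
  have hcoe := SparseCut.coe_cutFinset (m₁ := m₁) (m₂ := m₂) hk hq
  have hfin : (SparseCut.cutAtoms m₁ m₂ k q).Finite := hcoe ▸ Finset.finite_toSet _
  have hsingle := SparseCut.single_mem_convexHull_cutAtoms hk hkm hq hqm
  have hnhds : convexHull ℝ (SparseCut.cutAtoms m₁ m₂ k q) ∈ nhds 0 :=
    SparseCut.convex_mem_nhds_zero_of_single_mem (convex_convexHull ℝ _)
      ⟨_, (hsingle (⟨0, hk.trans hkm⟩, ⟨0, hq.trans hqm⟩)).1⟩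
      (mul_pos (SparseCut.one_div_sqrt_pos hk) (SparseCut.one_div_sqrt_pos hq)) hsingle
  have hball : {Z | SparseCut.cutNorm m₁ m₂ k q Z ≤ 1} =
      convexHull ℝ (SparseCut.cutAtoms m₁ m₂ k q) :=
    SparseCut.setOf_atomicNorm_le_one hfin hnhds
  have hext : Set.extremePoints ℝ {Z | SparseCut.cutNorm m₁ m₂ k q Z ≤ 1} =
      SparseCut.cutAtoms m₁ m₂ k q := by
    rw [hball]
    exact SparseCut.extremePoints_convexHull_eq_of_norm_eq_one fun A hA =>
      SparseCut.norm_eq_one_of_mem_cutAtoms hk hq hA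
  refine ⟨fun A hA => ?_, ⟨⟨_, hfin, hball⟩, ?_⟩, hext, ?_⟩
  · have hA' : A ∈ SparseCut.cutFinset m₁ m₂ k q := by rwa [← Finset.mem_coe, hcoe]
    have := SparseCut.integrable_sqNormProj_atomicNorm_and_statDim_le
      (SparseCut.cutFinset m₁ m₂ k q)
      (fun v hv w hw => SparseCut.exists_isometry_cutFinset hk hq hv hw)
      (by rw [hcoe]; exact hball) hA'
    rw [hcoe] at this
    exact ⟨this.1, this.2.trans (SparseCut.four_mul_log_card_cutFinset_le hk hkm hq hqm)⟩
  · rw [hext, hball]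
    intro v hv w hw
    rw [← hcoe, Finset.mem_coe] at hv hw
    obtain ⟨φ, hφ, hvw⟩ := SparseCut.exists_isometry_cutFinset hk hq hv hw
    refine ⟨φ.toAffineIsometryEquiv, ?_, hvw⟩
    have himg : φ '' SparseCut.cutAtoms m₁ m₂ k q = SparseCut.cutAtoms m₁ m₂ k q := by
      rw [← hcoe]
      ext x
      obtain ⟨x, rfl⟩ := φ.surjective x
      rw [φ.injective.mem_set_image, Finset.mem_coe, Finset.mem_coe, hφ]
    calc φ '' convexHull ℝ (SparseCut.cutAtoms m₁ m₂ k q)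
        = convexHull ℝ (φ '' SparseCut.cutAtoms m₁ m₂ k q) :=
          φ.toLinearEquiv.toLinearMap.image_convexHull _
      _ = _ := by rw [himg]
  · rw [hext, ← hcoe, Set.ncard_coe_finset, SparseCut.card_cutFinset hk hq]
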